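/- A Halin graph $H=T\cup C$ is a finite simple planar graph that is the union of a tree $T$ with no node of degree two and a cycle $C$ whose nodes are exactly the leaves (degree-one nodes) of $T$. Embeddings in the plane are given, as is usual for connected graphs, combinatorially: by the cyclic order of the edges around each node, subject to Euler's formula $|V|-|E|+|F|=2$, where the faces are obtained by face tracing, together with the choice of one face as the outer (unbounded) face. Let $H=T\cup C$ be a Halin graph embedded in the plane so that the edges of the outer face are exactly the edges of $C$. Let $e$ be an edge of the outer face and let $F_e$ be a face, other than the outer face, that also contains $e$. Then every Hamilton cycle of $H$ that does not contain $e$ contains all the other edges of $F_e$. -/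

import Mathlib

/-- A rotation system on `G`: for every vertex `x`, a cyclic order (say clockwise) of the edges
at `x`. The edges at `x` are represented by the darts (oriented edges) starting at `x`, and `rot`
sends each dart to the next one around its starting point. -/
structure RotationSystem {V : Type*} (G : SimpleGraph V) where
  rot : Equiv.Perm G.Dart
  rot_fst : ∀ d : G.Dart, (rot d).fst = d.fst
  rot_sameCycle : ∀ d d' : G.Dart, d.fst = d'.fst → rot.SameCycle d d'

namespace RotationSystem

variable {V : Type*} {G : SimpleGraph V}

/-- The face-tracing permutation: having walked along the dart `d` from `u` to `v`, one
continues along the dart that follows `v u` in the rotation at `v`. -/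
def facePerm (R : RotationSystem G) : Equiv.Perm G.Dart :=
  (Function.Involutive.toPerm SimpleGraph.Dart.symm SimpleGraph.Dart.symm_involutive).trans R.rot

/-- The faces are the orbits of face tracing. -/
def Face (R : RotationSystem G) : Type _ :=
  Quotient (Equiv.Perm.SameCycle.setoid R.facePerm)

/-- The face whose boundary walk traverses the dart `d`. -/
def faceOf (R : RotationSystem G) (d : G.Dart) : R.Face :=
  Quotient.mk (Equiv.Perm.SameCycle.setoid R.facePerm) d

/-- The edges on the boundary of a face. -/
def faceEdges (R : RotationSystem G) (F : R.Face) : Set (Sym2 V) :=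
  {e | ∃ d : G.Dart, R.faceOf d = F ∧ d.edge = e}

end RotationSystem

/-- A (combinatorial) embedding in the plane of a finite connected graph with at least one edge:
a rotation system that satisfies Euler's formula `|V| - |E| + |F| = 2`, that is, a cellular
embedding in the sphere, together with the face that is chosen as the unbounded one. -/
structure PlaneEmbedding {V : Type*} [Finite V] (G : SimpleGraph V) extends
    RotationSystem G where
  connected : G.Connected
  euler : Nat.card V + Nat.card toRotationSystem.Face = Nat.card G.edgeSet + 2
  outerFace : toRotationSystem.Face

/-- The graph `C` consists of a single cycle whose set of nodes is `S`
(the vertices outside `S` are isolated in `C`). -/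
def IsCycleGraphOn {V : Type*} (C : SimpleGraph V) (S : Set V) : Prop :=
  ∃ (u : V) (c : C.Walk u u), c.IsCycle ∧
    (∀ e, e ∈ C.edgeSet ↔ e ∈ c.edges) ∧ (∀ v, v ∈ S ↔ v ∈ c.support)

/-- `H = T ∪ C` is a Halin graph: `T` is a tree without nodes of degree two, `C` is a cycle
through the leaves of `T`, and the union of `T` and `C` is planar. -/
structure IsHalin {V : Type*} [Fintype V] (H T C : SimpleGraph V) [DecidableRel T.Adj] :
    Prop where
  isTree : T.IsTree
  degree_ne_two : ∀ v, T.degree v ≠ 2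
  cycle_leaves : IsCycleGraphOn C {v | T.degree v = 1}
  eq_union : H = T ⊔ C
  planar : Nonempty (PlaneEmbedding H)

/-! Each inner face has exactly one edge of `C`. A face bounded by tree edges alone would be closed
under reversal, hence contain every dart, so each face meets `C`; Euler's formula gives as many
inner faces as edges of `C`, and each such edge has at most one dart off the outer face, so both
counts are tight (`innerCycleDart_bijective`). Hence an edge `f ≠ e` of `Fe` is a tree edge.
Increments around a face cancel, so an edge of `C` crossing the fundamental cut of `f` shares an
inner face with `f` (`exists_face_of_crossing`). Besides `f`, the cut thus contains at most `e` and
one edge from the face across `f`. A Hamilton cycle avoiding `e` and `f` would cross it along at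
most one edge, which is impossible for a closed trail that reaches both sides. -/

namespace SimpleGraph

variable {V : Type*} {G : SimpleGraph V}

/-- The sum of the increments of a function along a walk. -/
theorem Walk.sum_darts_sub (g : V → ℤ) {u v : V} (p : G.Walk u v) :
    (p.darts.map fun d => g d.snd - g d.fst).sum = g v - g u := by
  induction p with
  | nil => simp
  | cons h p ih => simp [ih]

/-- A function that is constant along every edge of a walk takes the same value at its ends
and at all of its vertices. -/
theorem Walk.eq_of_forall_darts {α : Type*} (g : V → α) {u v : V} (p : G.Walk u v)
    (h : ∀ d ∈ p.darts, g d.fst = g d.snd) : ∀ w ∈ p.support, g w = g u := by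
  induction p with
  | nil => simp
  | cons hadj p ih =>
    simp only [Walk.darts_cons, List.mem_cons, forall_eq_or_imp] at h
    intro w hw
    rw [Walk.support_cons, List.mem_cons] at hw
    rcases hw with rfl | hw
    · rfl
    · exact (ih h.2 w hw).trans h.1.symm

/-- A closed trail cannot cross a cut along exactly one edge: if all its crossing edges agree,
then it stays on one side. -/
theorem Walk.IsTrail.eq_of_crossing_edges_eq (g : V → ℤ) {a : V} {p : G.Walk a a}
    (hp : p.IsTrail)
    (h : ∀ d ∈ p.darts, ∀ d' ∈ p.darts, g d.fst ≠ g d.snd → g d'.fst ≠ g d'.snd →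
      d.edge = d'.edge) : ∀ w ∈ p.support, g w = g a := by
  classical
  apply p.eq_of_forall_darts g
  intro d hd
  by_contra hne
  have hmap : (p.darts.map Dart.edge).Nodup := hp.edges_nodup
  have hnd : p.darts.Nodup := hmap.of_map
  have hsum := p.sum_darts_sub g
  -- The increments telescope to zero, and only `d` has a nonzero one.
  rw [← List.sum_toFinset _ hnd, Finset.sum_eq_single d] at hsum
  · apply hne
    linarith
  · intro d' hd' hdd'
    by_contra hne'
    rw [List.mem_toFinset] at hd'
    exact hdd' (List.inj_on_of_nodup_map hmap hd' hd
      (h d' hd' d hd (fun h' => hne' (by rw [h', sub_self])) hne))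
  · exact fun hd' => absurd (List.mem_toFinset.2 hd) hd'

/-- The fundamental cut of an edge of an acyclic graph, given as a function to the integers. -/
theorem IsAcyclic.exists_cut {T : SimpleGraph V} (hT : T.IsAcyclic) {u v : V} (huv : T.Adj u v) :
    ∃ g : V → ℤ, g u = 0 ∧ g v = 1 ∧ ∀ x y, T.Adj x y → g x ≠ g y → s(x, y) = s(u, v) := by
  classical
  have hb := isBridge_iff.1 (isAcyclic_iff_forall_adj_isBridge.1 hT huv)
  refine ⟨fun x => if (T.deleteEdges {s(u, v)}).Reachable u x then 0 else 1,
    if_pos (Reachable.refl _), if_neg (by simpa using hb), fun x y hxy hne => ?_⟩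
  by_contra hs
  apply hne
  have hadj : (T.deleteEdges {s(u, v)}).Adj x y := by
    rw [deleteEdges_adj]
    exact ⟨hxy, by simpa using hs⟩
  have : (T.deleteEdges {s(u, v)}).Reachable u x ↔ (T.deleteEdges {s(u, v)}).Reachable u y :=
    ⟨fun h => h.trans hadj.reachable, fun h => h.trans hadj.symm.reachable⟩
  simp only [this]

/-- In a connected graph with an edge between two leaves, there are no other vertices. -/
theorem Connected.eq_or_eq_of_adj_of_degree_eq_one [Fintype V] {T : SimpleGraph V}
    [DecidableRel T.Adj] (hT : T.Connected) {u v : V} (huv : T.Adj u v)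
    (hu : T.degree u = 1) (hv : T.degree v = 1) (x : V) : x = u ∨ x = v := by
  have huniq : ∀ {a b c : V}, T.degree a = 1 → T.Adj a b → T.Adj a c → b = c := by
    intro a b c ha hb hc
    rw [← card_neighborFinset_eq_degree, Finset.card_eq_one] at ha
    obtain ⟨z, hz⟩ := ha
    have h1 : b ∈ T.neighborFinset a := by simpa using hb
    have h2 : c ∈ T.neighborFinset a := by simpa using hc
    rw [hz, Finset.mem_singleton] at h1 h2
    rw [h1, h2]
  obtain ⟨p⟩ := hT.preconnected u x
  have key : ∀ {y z : V} (q : T.Walk y z), y = u ∨ y = v → z = u ∨ z = v := by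
    intro y z q
    induction q with
    | nil => exact id
    | cons h q ih =>
      rintro (rfl | rfl)
      · exact ih (Or.inr (huniq hu h huv))
      · exact ih (Or.inl (huniq hv h huv.symm))
  exact key p (Or.inl rfl)

end SimpleGraph

/-! ### Faces of a rotation system -/

namespace RotationSystem

variable {V : Type*} {G : SimpleGraph V} (R : RotationSystem G)

theorem facePerm_fst (d : G.Dart) : (R.facePerm d).fst = d.snd := R.rot_fst d.symm

theorem facePerm_symm (d : G.Dart) : R.facePerm d.symm = R.rot d := by
  change R.rot d.symm.symm = R.rot d
  rw [SimpleGraph.Dart.symm_symm]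

theorem faceOf_eq_iff {d d' : G.Dart} :
    R.faceOf d = R.faceOf d' ↔ R.facePerm.SameCycle d d' :=
  Quotient.eq (r := Equiv.Perm.SameCycle.setoid R.facePerm)

theorem faceOf_facePerm (d : G.Dart) : R.faceOf (R.facePerm d) = R.faceOf d := by
  rw [faceOf_eq_iff, Equiv.Perm.sameCycle_apply_left]

theorem faceOf_surjective : Function.Surjective R.faceOf := Quotient.mk_surjective

/-- The increments of a function around a face sum to zero. -/
theorem sum_face_sub [Fintype G.Dart] [DecidableEq R.Face] (F : R.Face) (g : V → ℤ) :
    ∑ d : G.Dart with R.faceOf d = F, (g d.snd - g d.fst) = 0 := by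
  rw [Finset.sum_sub_distrib, sub_eq_zero]
  refine Finset.sum_equiv R.facePerm (fun d => ?_) (fun d _ => ?_)
  · simp [faceOf_facePerm]
  · rw [facePerm_fst]

/-- A set of darts that contains, with every dart, its reverse and the whole face it lies on,
contains all darts with the same starting point. -/
theorem mem_of_fst_eq {S : Set G.Dart} (hsymm : ∀ d ∈ S, d.symm ∈ S)
    (hface : ∀ d ∈ S, ∀ d', R.faceOf d' = R.faceOf d → d' ∈ S) {d d' : G.Dart} (hd : d ∈ S)
    (h : d.fst = d'.fst) : d' ∈ S := by
  have hrot : ∀ x, x ∈ S ↔ R.rot x ∈ S := by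
    intro x
    have hx : R.faceOf (R.rot x) = R.faceOf x.symm := by
      rw [← facePerm_symm, faceOf_facePerm]
    refine ⟨fun hxS => hface _ (hsymm x hxS) _ hx, fun hxS => ?_⟩
    have := hsymm _ (hface _ hxS _ hx.symm)
    rwa [SimpleGraph.Dart.symm_symm] at this
  have hz : ∀ (n : ℤ) (x : G.Dart), x ∈ S ↔ (R.rot ^ n) x ∈ S := by
    intro n
    induction n with
    | zero => simp
    | succ n ih =>
      intro x
      rw [zpow_add_one, Equiv.Perm.mul_apply, ← ih, ← hrot]
    | pred n ih =>
      intro x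
      rw [zpow_sub_one, Equiv.Perm.mul_apply, ← ih, hrot (R.rot⁻¹ x),
        ← Equiv.Perm.mul_apply, mul_inv_cancel, Equiv.Perm.one_apply]
  obtain ⟨n, hn⟩ := R.rot_sameCycle d d' h
  rw [← hn]
  exact (hz n d).1 hd

/-- In a connected graph, a nonempty union of faces that is closed under reversal contains
all darts. -/
theorem mem_of_connected (hG : G.Connected) {S : Set G.Dart} (hne : S.Nonempty)
    (hsymm : ∀ d ∈ S, d.symm ∈ S)
    (hface : ∀ d ∈ S, ∀ d', R.faceOf d' = R.faceOf d → d' ∈ S) (d : G.Dart) : d ∈ S := by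
  obtain ⟨d₀, hd₀⟩ := hne
  have key : ∀ {x y : V} (_ : G.Walk x y), (∀ d' : G.Dart, d'.fst = x → d' ∈ S) →
      ∀ d' : G.Dart, d'.fst = y → d' ∈ S := by
    intro x y p
    induction p with
    | nil => exact id
    | cons hadj p ih =>
      intro hx
      refine ih fun d' hd' => ?_
      exact R.mem_of_fst_eq hsymm hface (hsymm _ (hx ⟨(_, _), hadj⟩ rfl)) hd'.symm
  obtain ⟨p⟩ := hG.preconnected d₀.fst d.fst
  exact key p (fun d' hd' => R.mem_of_fst_eq hsymm hface hd₀ hd'.symm) d rfl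

/-- If some edge lies outside an acyclic subgraph, then the boundary of every face contains such
an edge. -/
theorem exists_dart_not_mem_of_isAcyclic [Finite V] (hG : G.Connected) {T : SimpleGraph V}
    (hT : T.IsAcyclic) (hne : ∃ d : G.Dart, d.edge ∉ T.edgeSet) (F : R.Face) :
    ∃ d : G.Dart, R.faceOf d = F ∧ d.edge ∉ T.edgeSet := by
  classical
  have := Fintype.ofFinite V
  by_contra! hF
  obtain ⟨d₁, hd₁⟩ := hne
  obtain ⟨d₀, hd₀⟩ := R.faceOf_surjective F
  refine hd₁ (hF d₁ (R.mem_of_connected hG (S := {d | R.faceOf d = F}) ⟨d₀, hd₀⟩ ?_ ?_ d₁))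
  · intro d hd
    by_contra hds
    change R.faceOf d = F at hd
    change ¬ R.faceOf d.symm = F at hds
    obtain ⟨g, h0, h1, hcut⟩ := hT.exists_cut (hF d hd)
    have hsum := R.sum_face_sub F g
    -- Without its reverse, `d` alone would cross its fundamental cut on `F`, and the sum would be
    -- 1.
    rw [Finset.sum_eq_single d, h0, h1] at hsum
    · norm_num at hsum
    · intro d' hd' hdd'
      rw [Finset.mem_filter_univ] at hd'
      by_contra hne
      rcases (SimpleGraph.dart_edge_eq_iff d' d).1
        (hcut d'.fst d'.snd (hF d' hd') fun h => hne (by rw [h, sub_self])) with h | h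
      · exact hdd' h
      · exact hds (h ▸ hd')
    · exact fun h => absurd ((Finset.mem_filter_univ d).2 hd) h
  · intro d hd d' hd'
    exact hd'.trans hd

end RotationSystem

/-! ### Inner faces of a Halin graph -/

namespace IsHalin

variable {V : Type*} [Fintype V] {H T C : SimpleGraph V} [DecidableRel T.Adj]

/-- The tree and the cycle of a Halin graph have no common edge. -/
theorem disjoint_edgeSet (hH : IsHalin H T C) : Disjoint T.edgeSet C.edgeSet := by
  classical
  rw [Set.disjoint_left]
  intro f hfT hfC
  induction f with
  | h u v =>
  obtain ⟨w, c, hc, hce, hcs⟩ := hH.cycle_leaves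
  have hf := (hce _).1 hfC
  have hu := (hcs u).2 (c.fst_mem_support_of_mem_edges hf)
  have hv := (hcs v).2 (c.snd_mem_support_of_mem_edges hf)
  -- A common edge would join two leaves, leaving only two vertices for a cycle of length at least
  -- three.
  have hall := hH.isTree.connected.eq_or_eq_of_adj_of_degree_eq_one hfT hu hv
  have hsub : (Finset.univ : Finset V) ⊆ {u, v} := by
    intro x _
    simpa using hall x
  have hcard := (Finset.card_le_card hsub).trans Finset.card_le_two
  have h3 := hc.three_le_length
  have hnd := hc.support_nodup.length_le_card
  simp at hnd
  rw [Finset.card_univ] at hcard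
  omega

variable (M : PlaneEmbedding H)

/-- The darts over the cycle of a Halin graph that do not lie on the outer face. -/
def innerCycleDart (C : SimpleGraph V) (M : PlaneEmbedding H) : Type _ :=
  {d : H.Dart // d.edge ∈ C.edgeSet ∧ M.faceOf d ≠ M.outerFace}

theorem mem_edgeSet_or (hH : IsHalin H T C) (d : H.Dart) :
    d.edge ∈ T.edgeSet ∨ d.edge ∈ C.edgeSet := by
  have hE : H.edgeSet = T.edgeSet ∪ C.edgeSet := by rw [hH.eq_union, SimpleGraph.edgeSet_sup]
  exact hE.subset d.edge_mem

/-- Euler's formula: a Halin graph has as many inner faces as its cycle has edges. -/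
theorem card_inner_faces (hH : IsHalin H T C) :
    Nat.card {F : M.Face // F ≠ M.outerFace} = Nat.card C.edgeSet := by
  classical
  have : Finite M.Face := Finite.of_surjective _ M.toRotationSystem.faceOf_surjective
  have := Fintype.ofFinite M.Face
  have hT := hH.isTree.card_edgeFinset
  have hE : Nat.card H.edgeSet = Nat.card T.edgeSet + Nat.card C.edgeSet := by
    rw [hH.eq_union, SimpleGraph.edgeSet_sup]
    exact Set.ncard_union_eq hH.disjoint_edgeSet (Set.toFinite _) (Set.toFinite _)
  have hT' : Nat.card T.edgeSet = T.edgeFinset.card := by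
    rw [Nat.card_eq_fintype_card, SimpleGraph.edgeFinset_card]
  have heuler := M.euler
  have hF : Nat.card {F : M.Face // F ≠ M.outerFace} = Nat.card M.Face - 1 := by
    rw [Nat.card_eq_fintype_card, Nat.card_eq_fintype_card, Fintype.card_subtype_compl,
      Fintype.card_subtype_eq]
  rw [Nat.card_eq_fintype_card (α := V)] at heuler
  omega

theorem exists_innerCycleDart_face (hH : IsHalin H T C) (F : M.Face) (hF : F ≠ M.outerFace) :
    ∃ d : innerCycleDart C M, M.faceOf d.1 = F := by
  obtain ⟨w, c, hc, hce, -⟩ := hH.cycle_leaves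
  have hne : ∃ d : H.Dart, d.edge ∉ T.edgeSet := by
    cases c with
    | nil => exact (SimpleGraph.Walk.not_isCycle_nil hc).elim
    | cons h p =>
      refine ⟨⟨(_, _), by rw [hH.eq_union]; exact Or.inr h⟩, fun hT => ?_⟩
      exact Set.disjoint_left.1 hH.disjoint_edgeSet hT h
  obtain ⟨d, hd, hdT⟩ := M.toRotationSystem.exists_dart_not_mem_of_isAcyclic M.connected
    hH.isTree.isAcyclic hne F
  exact ⟨⟨d, (hH.mem_edgeSet_or d).resolve_left hdT, fun h => hF (hd.symm.trans h)⟩, hd⟩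

/-- By `hM`, one of the two darts over each edge of the cycle is on the outer face. -/
theorem innerCycleDart_edge_injective (hM : M.faceEdges M.outerFace = C.edgeSet) :
    Function.Injective fun d : innerCycleDart C M => (⟨d.1.edge, d.2.1⟩ : C.edgeSet) := by
  rintro ⟨d, hd, hdO⟩ ⟨d', hd', hdO'⟩ h
  have hdd' : d.edge = d'.edge := congrArg Subtype.val h
  refine Subtype.ext (((SimpleGraph.dart_edge_eq_iff d d').1 hdd').resolve_right fun hs => ?_)
  obtain ⟨x, hxO, hx⟩ := hM.symm ▸ hd
  rcases (SimpleGraph.dart_edge_eq_iff x d).1 hx with rfl | rfl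
  · exact hdO hxO
  · rw [hs, SimpleGraph.Dart.symm_symm] at hxO
    exact hdO' hxO

/-- Every inner face has exactly one dart over the cycle, and every edge of the cycle has exactly
one dart on an inner face. -/
theorem innerCycleDart_bijective (hH : IsHalin H T C)
    (hM : M.faceEdges M.outerFace = C.edgeSet) :
    (Function.Bijective fun d : innerCycleDart C M => (⟨M.faceOf d.1, d.2.2⟩ :
      {F : M.Face // F ≠ M.outerFace})) ∧
    Function.Bijective fun d : innerCycleDart C M => (⟨d.1.edge, d.2.1⟩ : C.edgeSet) := by
  classical
  have : Finite (innerCycleDart C M) := Subtype.finite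
  have hinj := innerCycleDart_edge_injective M hM
  have hsurj : Function.Surjective fun d : innerCycleDart C M => (⟨M.faceOf d.1, d.2.2⟩ :
      {F : M.Face // F ≠ M.outerFace}) := by
    rintro ⟨F, hF⟩
    obtain ⟨d, hd⟩ := hH.exists_innerCycleDart_face M F hF
    exact ⟨d, Subtype.ext hd⟩
  -- Inner faces ≤ inner cycle darts ≤ edges of `C`, with equal ends.
  have hle := Nat.card_le_card_of_injective _ hinj
  have hge := Nat.card_le_card_of_surjective _ hsurj
  have hcard := hH.card_inner_faces M
  exact ⟨(Nat.bijective_iff_surjective_and_card _).2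
      ⟨hsurj, (hle.trans_eq hcard.symm).antisymm hge⟩,
    (Nat.bijective_iff_injective_and_card _).2 ⟨hinj, hle.antisymm (hcard.symm.trans_le hge)⟩⟩

theorem dart_eq_of_faceOf_eq (hH : IsHalin H T C) (hM : M.faceEdges M.outerFace = C.edgeSet)
    {d d' : H.Dart} (hd : d.edge ∈ C.edgeSet) (hd' : d'.edge ∈ C.edgeSet)
    (h : M.faceOf d = M.faceOf d') (hO : M.faceOf d ≠ M.outerFace) : d = d' := by
  have := (hH.innerCycleDart_bijective M hM).1.1 (a₁ := ⟨d, hd, hO⟩) (a₂ := ⟨d', hd', h ▸ hO⟩)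
    (Subtype.ext h)
  exact congrArg Subtype.val this

/-- An edge of the cycle that crosses the fundamental cut of a tree edge `d` lies on an inner
face that contains `d` or its reverse. -/
theorem exists_face_of_crossing (hH : IsHalin H T C)
    (hM : M.faceEdges M.outerFace = C.edgeSet) {d : H.Dart} {g : V → ℤ}
    (hcut : ∀ x y, T.Adj x y → g x ≠ g y → s(x, y) = d.edge) {x : H.Dart}
    (hx : x.edge ∈ C.edgeSet) (hgx : g x.fst ≠ g x.snd) :
    ∃ y : H.Dart, y.edge = x.edge ∧ M.faceOf y ≠ M.outerFace ∧
      (M.faceOf y = M.faceOf d ∨ M.faceOf y = M.faceOf d.symm) := by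
  classical
  obtain ⟨⟨y, hyC, hyO⟩, hy⟩ := (hH.innerCycleDart_bijective M hM).2.2 ⟨x.edge, hx⟩
  have hyx : y.edge = x.edge := congrArg Subtype.val hy
  refine ⟨y, hyx, hyO, ?_⟩
  by_contra! hcon
  have hgy : g y.snd - g y.fst ≠ 0 := by
    rw [sub_ne_zero]
    rcases (SimpleGraph.dart_edge_eq_iff y x).1 hyx with rfl | rfl
    · exact hgx.symm
    · exact hgx
  have hsum := M.toRotationSystem.sum_face_sub (M.faceOf y) g
  -- If neither `d` nor `d.symm` is on this face, only `y` crosses the cut there.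
  rw [Finset.sum_eq_single y] at hsum
  · exact hgy hsum
  · intro z hz hzy
    rw [Finset.mem_filter_univ] at hz
    by_contra hne
    rcases hH.mem_edgeSet_or z with hzT | hzC
    · rcases (SimpleGraph.dart_edge_eq_iff z d).1
        (hcut z.fst z.snd hzT fun h => hne (by rw [h, sub_self])) with rfl | rfl
      · exact hcon.1 hz.symm
      · exact hcon.2 hz.symm
    · exact hzy (hH.dart_eq_of_faceOf_eq M hM hzC hyC hz (hz ▸ hyO))
  · exact fun h =>
      (h ((Finset.mem_filter_univ (p := fun z => M.faceOf z = M.faceOf y) y).2 rfl)).elim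

end IsHalin

theorem mainTheorem7 {V : Type*} [Fintype V] [DecidableEq V]
    (H T C : SimpleGraph V) [DecidableRel T.Adj] (hH : IsHalin H T C)
    (M : PlaneEmbedding H) (hM : M.faceEdges M.outerFace = C.edgeSet)
    (e : Sym2 V) (he : e ∈ M.faceEdges M.outerFace)
    (Fe : M.Face) (hFe : Fe ≠ M.outerFace) (heFe : e ∈ M.faceEdges Fe)
    (a : V) (τ : H.Walk a a) (hτ : τ.IsHamiltonianCycle) (heτ : e ∉ τ.edges) :
    ∀ f ∈ M.faceEdges Fe, f ≠ e → f ∈ τ.edges := by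
  rintro f ⟨d, hdF, rfl⟩ hfe
  by_contra hfτ
  rw [hM] at he
  obtain ⟨c, hcF, rfl⟩ := heFe
  have hdT : d.edge ∈ T.edgeSet := (hH.mem_edgeSet_or d).resolve_right fun hdC => hfe <|
    congrArg _ (hH.dart_eq_of_faceOf_eq M hM hdC he (hdF.trans hcF.symm) (hdF ▸ hFe))
  obtain ⟨g, h0, h1, hcut⟩ := hH.isTree.isAcyclic.exists_cut hdT
  have hcross : ∀ x ∈ τ.darts, g x.fst ≠ g x.snd → ∃ y : H.Dart, y.edge = x.edge ∧
      y.edge ∈ C.edgeSet ∧ M.faceOf y ≠ M.outerFace ∧ M.faceOf y = M.faceOf d.symm := by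
    intro x hx hgx
    have hxτ : x.edge ∈ τ.edges := List.mem_map_of_mem hx
    have hxC : x.edge ∈ C.edgeSet := (hH.mem_edgeSet_or x).resolve_left fun hxT =>
      hfτ (by
        have hxd : x.edge = d.edge := hcut x.fst x.snd hxT hgx
        rwa [← hxd])
    obtain ⟨y, hyx, hyO, hy | hy⟩ := hH.exists_face_of_crossing M hM hcut hxC hgx
    -- The face of `d` is `Fe`, whose only cycle edge is the avoided one.
    · have hyc : y = c := hH.dart_eq_of_faceOf_eq M hM (hyx ▸ hxC) he
        (hy.trans (hdF.trans hcF.symm)) hyO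
      exact absurd (by rwa [← hyc, hyx]) heτ
    · exact ⟨y, hyx, hyx ▸ hxC, hyO, hy⟩
  have hconst := hτ.isCycle.isCircuit.isTrail.eq_of_crossing_edges_eq g (by
    intro x hx x' hx' hgx hgx'
    obtain ⟨y, hyx, hyC, hyO, hy⟩ := hcross x hx hgx
    obtain ⟨y', hyx', hyC', -, hy'⟩ := hcross x' hx' hgx'
    rw [← hyx, ← hyx', hH.dart_eq_of_faceOf_eq M hM hyC hyC' (hy.trans hy'.symm) hyO])
  have hd0 := hconst d.fst (hτ.mem_support _)
  have hd1 := hconst d.snd (hτ.mem_support _)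
  exact zero_ne_one (h0.symm.trans (hd0.trans (hd1.symm.trans h1)))
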